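/- Let $\mathbb{Q}=(\Omega,\le,\otimes,k)$ be a Lawverean quantale, i.e. a unital quantale that is commutative, integral ($k=\top$), cointegral ($\varepsilon\otimes\delta=\bot$ implies $\varepsilon=\bot$ or $\delta=\bot$) and non-trivial ($k\neq\bot$). A *change of base endofunctor* (CBE) is a monotone map $\phi:\Omega\to\Omega$ with $\phi(k)=k$ and $\phi(\varepsilon\otimes\delta)=\phi(\varepsilon)\otimes\phi(\delta)$ that is continuous, i.e. preserves suprema of non-empty directed sets. Let $\Phi$ be a set of CBEs that contains the identity and the constant map $k$ and is closed under composition and pointwise tensor. A $\Phi$-graded signature $\Sigma$ assigns to each $n$-ary function symbol $f$ grades $\phi_1,\dots,\phi_n\in\Phi$, written $f:(\phi_1,\dots,\phi_n)$. Terms are built from $\Sigma$ and an infinite set of variables. The grade of a variable $x$ in a term is the map $\Omega\to\Omega$ given by $\partial_x(x)=\mathrm{id}$, $\partial_x(y)=(\varepsilon\mapsto k)$ for a variable $y\ne x$, and $\partial_x(f(e_1,\dots,e_n))=\bigotimes_i \phi_i\circ\partial_x(e_i)$ (the empty tensor is the constant map $k$). The grade $\partial_C$ of a one-hole context $C$ is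 the composite of the grades of the arguments passed on the way from the root to the hole. A $(\mathbb{Q},\Phi)$-term rewriting system $\mathcal{R}=(\Sigma,\mapsto_R)$ consists of a $\Phi$-graded signature and a relation $\varepsilon\Vdash a\mapsto_R b$ between terms $a,b$ and $\varepsilon\in\Omega$ that is antitone in $\varepsilon$ (if $\varepsilon\Vdash a\mapsto_R b$ and $\delta\le\varepsilon$ then $\delta\Vdash a\mapsto_R b$). A triple in this relation is called a rule, and every variable of its right-hand side $b$ is required to occur in its left-hand side $a$. The reduction $\varepsilon\Vdash e\to_R f$ is the least relation such that $\partial_C(\varepsilon)\Vdash C[a^\sigma]\to_R C[b^\sigma]$ whenever $\varepsilon\Vdash a\mapsto_R b$, $C$ is a one-hole context and $\sigma$ a substitution, and such that $\varepsilon\Vdash e\to_R f$ and $\delta\le\varepsilon$ imply $\delta\Vdash e\to_R f$. Put $R(e,f)=\bigvee\{\varepsilon\mid \varepsilon\Vdash e\to_R f\}$. $\mathcal{R}$ is *balanced* if $\partial_x(a)=\partial_x(b)$ for every rule $\varepsilon\Vdash a\mapsto_R b$ and every variable $x$. It is *left-linear* if no variable occurs twice in the left-hand side of a rule. A *critical pair*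 is a pair $(c^\sigma[b^\sigma]_p,\,d^\sigma)$, where $\varepsilon\Vdash a\mapsto b$ and $\delta\Vdash c\mapsto d$ are renamings of rules without common variables, $p$ is a position of a function symbol in $c$, the map $\sigma$ is a most general unifier of $a$ and $c_{|p}$, and, if $p$ is the root, $(c,d)$ is not obtained from $(a,b)$ by renaming variables. $\mathcal{R}$ is *orthogonal* if it is left-linear and has no critical pair. For $\Omega$-valued relations let $(S;T)(a,c)=\bigvee_b S(a,b)\otimes T(b,c)$, let $\Delta(a,a)=k$ and $\Delta(a,b)=\bot$ for $a\ne b$, and let $S^\circ(a,b)=S(b,a)$ and $S^*=\bigvee_{n\ge0}S^n$. The relation $S$ is *confluent* if $(S^*)^\circ;S^*\le S^*;(S^*)^\circ$ pointwise. For ternary relations the same operations are: $\varepsilon\Vdash a\,(S;T)\,c$ iff there are $b,\delta,\eta$ with $\delta\Vdash a\,S\,b$, $\eta\Vdash b\,T\,c$ and $\varepsilon\le\delta\otimes\eta$; $\varepsilon\Vdash a\,\Delta\,b$ iff $a=b$ and $\varepsilon\le k$; and $S^*=\bigcup_n S^n$. A ternary relation $\to$ is *confluent* if $\varepsilon_1\Vdash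 e\to^* f_1$ and $\varepsilon_2\Vdash e\to^* f_2$ imply that there are $f,\delta_1,\delta_2$ with $\delta_1\Vdash f_1\to^* f$, $\delta_2\Vdash f_2\to^* f$ and $\varepsilon_1\otimes\varepsilon_2\le\delta_1\otimes\delta_2$. **Theorem.** Let $\mathcal{R}=(\Sigma,\mapsto_R)$ be an orthogonal, balanced $(\mathbb{Q},\Phi)$-term rewriting system. Then the $\Omega$-valued relation $R$ is confluent, and so is the ternary relation $\to_R$. -/

import Mathlib

namespace GradedRewriting

universe u v w z

/-! ### Quantales and change of base endofunctors -/

/-- A Lawverean quantale: commutative (through `CommMonoid`), integral, cointegral and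
non-trivial. The unit `k` is `1` and the tensor is `*`. -/
class LawvereanQuantale (Ω : Type z) [CommMonoid Ω] [CompleteLattice Ω] : Prop
    extends IsQuantale Ω where
  one_eq_top : (1 : Ω) = ⊤
  cointegral : ∀ ε δ : Ω, ε * δ = ⊥ → ε = ⊥ ∨ δ = ⊥
  one_ne_bot : (1 : Ω) ≠ ⊥

/-- A change of base endofunctor (CBE): a monotone endomap of the quantale that preserves unit and
tensor (with equality) and is continuous. Continuity is preservation of suprema of non-empty
directed sets, so that constant maps are continuous and so that continuous maps are closed under
the pointwise tensor. -/
structure IsCBE {Ω : Type z} [CommMonoid Ω] [CompleteLattice Ω] (φ : Ω → Ω) : Prop where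
  monotone : Monotone φ
  map_one : φ 1 = 1
  map_mul : ∀ ε δ, φ (ε * δ) = φ ε * φ δ
  continuous : ScottContinuous φ

/-- The structure `Φ`: a set of CBEs containing the identity and the constant `k` map, and closed
under composition and pointwise tensor. -/
structure GradeStructure (Ω : Type z) [CommMonoid Ω] [CompleteLattice Ω] where
  carrier : Set (Ω → Ω)
  isCBE : ∀ φ ∈ carrier, IsCBE φ
  id_mem : id ∈ carrier
  const_mem : (fun _ => 1) ∈ carrier
  comp_mem : ∀ φ ∈ carrier, ∀ ψ ∈ carrier, φ ∘ ψ ∈ carrier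
  tensor_mem : ∀ φ ∈ carrier, ∀ ψ ∈ carrier, (fun ε => φ ε * ψ ε) ∈ carrier

/-! ### Quantale-valued relations -/

section QRel

variable {Ω : Type z} [CommMonoid Ω] [CompleteLattice Ω] {A : Type w}

open Classical in
/-- The diagonal relation. -/
noncomputable def QRel.diag : A → A → Ω := fun a b => if a = b then 1 else ⊥

/-- Composition of quantale-valued relations. -/
def QRel.comp (R S : A → A → Ω) : A → A → Ω := fun a c => ⨆ b, R a b * S b c

/-- The transpose. -/
def QRel.dual (R : A → A → Ω) : A → A → Ω := fun a b => R b a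

/-- The iterates: `R⁰ = Δ`, `Rⁿ⁺¹ = R ; Rⁿ`. -/
noncomputable def QRel.iter (R : A → A → Ω) : ℕ → A → A → Ω
  | 0 => QRel.diag
  | n + 1 => QRel.comp R (QRel.iter R n)

/-- The reflexive and transitive closure. -/
noncomputable def QRel.star (R : A → A → Ω) : A → A → Ω := fun a b => ⨆ n, QRel.iter R n a b

/-- The diamond property `R° ; R ≤ R ; R°` (with `R°` the transpose). -/
def QRel.Diamond (R : A → A → Ω) : Prop :=
  QRel.comp (QRel.dual R) R ≤ QRel.comp R (QRel.dual R)

/-- Confluence: the reflexive and transitive closure has the diamond property. -/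
def QRel.Confluent (R : A → A → Ω) : Prop := QRel.Diamond (QRel.star R)

end QRel

/-! ### Ternary relations; `T a ε b` is read `ε ⊩ a T b` -/

section TRel

variable {Ω : Type z} [CommMonoid Ω] [CompleteLattice Ω] {A : Type w}

/-- The ternary diagonal relation. -/
def TRel.diag : A → Ω → A → Prop := fun a ε b => a = b ∧ ε ≤ 1

/-- Composition of ternary relations. -/
def TRel.comp (S T : A → Ω → A → Prop) : A → Ω → A → Prop :=
  fun a ε c => ∃ b δ η, S a δ b ∧ T b η c ∧ ε ≤ δ * η

/-- The transpose. -/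
def TRel.dual (T : A → Ω → A → Prop) : A → Ω → A → Prop := fun a ε b => T b ε a

/-- The iterates. -/
def TRel.iter (T : A → Ω → A → Prop) : ℕ → A → Ω → A → Prop
  | 0 => TRel.diag
  | n + 1 => TRel.comp T (TRel.iter T n)

/-- The reflexive and transitive closure. -/
def TRel.star (T : A → Ω → A → Prop) : A → Ω → A → Prop := fun a ε b => ∃ n, TRel.iter T n a ε b

/-- The diamond property `T° ; T ⊆ T ; T°` (with `T°` the transpose). -/
def TRel.Diamond (T : A → Ω → A → Prop) : Prop :=
  ∀ a ε b, TRel.comp (TRel.dual T) T a ε b → TRel.comp T (TRel.dual T) a ε b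

/-- Confluence: the reflexive and transitive closure has the diamond property. -/
def TRel.Confluent (T : A → Ω → A → Prop) : Prop := TRel.Diamond (TRel.star T)

/-- The quantale-valued relation induced by a ternary relation. -/
def TRel.toQRel (T : A → Ω → A → Prop) : A → A → Ω := fun a b => sSup {ε | T a ε b}

end TRel

/-! ### Terms and contexts -/

section Terms

variable {L : FirstOrder.Language.{u, v}} {X : Type w}

open Classical in
/-- The set of variables of a term. -/
noncomputable def vars (t : L.Term X) : Set X := t.varFinset

open Classical in
/-- The number of occurrences of the variable `x` in a term. -/
noncomputable def occ (x : X) : L.Term X → ℕ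
  | .var y => if y = x then 1 else 0
  | .func _ ts => ∑ i, occ x (ts i)

/-- A term is linear if it has no multiple occurrences of the same variable. -/
def IsLinear (t : L.Term X) : Prop := ∀ x, occ x t ≤ 1

/-- Contexts with exactly one hole. In `Ctx.func f i ts C` the `i`-th argument of `f` is the
context `C`, and the `j`-th argument, for `j ≠ i`, is `ts j`; the term `ts i` is immaterial. -/
inductive Ctx (L : FirstOrder.Language.{u, v}) (X : Type w) : Type (max u w)
  | hole : Ctx L X
  | func {n : ℕ} (f : L.Functions n) (i : Fin n) (ts : Fin n → L.Term X) (C : Ctx L X) : Ctx L X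

/-- `C.fill t` is `C[t]`. -/
def Ctx.fill : Ctx L X → L.Term X → L.Term X
  | .hole, t => t
  | .func f i ts C, t => .func f (Function.update ts i (C.fill t))

/-- Application of a substitution to a context. -/
def Ctx.subst : Ctx L X → (X → L.Term X) → Ctx L X
  | .hole, _ => .hole
  | .func f i ts C, σ => .func f i (fun j => (ts j).subst σ) (C.subst σ)

/-- `σ` is a unifier of `s` and `t`. -/
def IsUnifier (σ : X → L.Term X) (s t : L.Term X) : Prop := s.subst σ = t.subst σ

/-- `σ` is a most general unifier of `s` and `t`: every unifier is `σ` followed by some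
substitution. -/
def IsMGU (σ : X → L.Term X) (s t : L.Term X) : Prop :=
  IsUnifier σ s t ∧ ∀ τ, IsUnifier τ s t → ∃ ρ : X → L.Term X, ∀ x, τ x = (σ x).subst ρ

/-- The rules with sides `a`, `b` and `c`, `d` are variants: the second one is obtained from the
first one by renaming the variables. -/
def AreVariants (a b c d : L.Term X) : Prop :=
  ∃ ρ : Equiv.Perm X, a.relabel ρ = c ∧ b.relabel ρ = d

end Terms

/-! ### Graded term rewriting systems -/

/-- A `(Ω, Φ)`-term rewriting system over the function symbols of `L` and the variables `X`:
a modal arity for each function symbol, with grades in `Φ`, and a ternary relation on terms that is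
antitone in the quantale argument. -/
structure GradedTRS {Ω : Type z} [CommMonoid Ω] [CompleteLattice Ω] (Φ : GradeStructure Ω)
    (L : FirstOrder.Language.{u, v}) (X : Type w) where
  /-- `grade f i` is the sensitivity of `f` on its `i`-th argument. -/
  grade : ∀ {n : ℕ}, L.Functions n → Fin n → Ω → Ω
  grade_mem : ∀ {n : ℕ} (f : L.Functions n) (i : Fin n), grade f i ∈ Φ.carrier
  /-- `rule a ε b` is `ε ⊩ a ↦ b`. -/
  rule : L.Term X → Ω → L.Term X → Prop
  rule_anti : ∀ {a : L.Term X} {ε δ : Ω} {b : L.Term X}, rule a ε b → δ ≤ ε → rule a δ b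

namespace GradedTRS

variable {Ω : Type z} [CommMonoid Ω] [CompleteLattice Ω] {Φ : GradeStructure Ω}
  {L : FirstOrder.Language.{u, v}} {X : Type w} (R : GradedTRS Φ L X)

open Classical in
/-- The grade of the variable `x` in a term, as a map on the quantale. -/
noncomputable def deg (x : X) : L.Term X → Ω → Ω
  | .var y => if y = x then id else fun _ => 1
  | .func f ts => fun ε => ∏ i, R.grade f i (deg x (ts i) ε)

/-- The grade of the hole of a context. -/
def degCtx : Ctx L X → Ω → Ω
  | .hole => id
  | .func f i _ C => R.grade f i ∘ degCtx C

/-- The rewriting ternary relation generated by the rules; `R.Step e ε f` is `ε ⊩ e → f`. -/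
inductive Step : L.Term X → Ω → L.Term X → Prop
  | rule {a : L.Term X} {ε : Ω} {b : L.Term X} (C : Ctx L X) (σ : X → L.Term X) :
      R.rule a ε b → Step (C.fill (a.subst σ)) (R.degCtx C ε) (C.fill (b.subst σ))
  | weaken {e : L.Term X} {ε δ : Ω} {f : L.Term X} : Step e ε f → δ ≤ ε → Step e δ f

/-- The rewriting quantale-valued relation `R(e, f) = ⋁ {ε | ε ⊩ e → f}`. -/
def rel : L.Term X → L.Term X → Ω := TRel.toQRel R.Step

/-- The two sides of each rule give the same grade to each variable. -/
def Balanced : Prop := ∀ a ε b, R.rule a ε b → ∀ x, R.deg x a = R.deg x b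

/-- Each variable of the contractum of a rule occurs in its redex. -/
def VariableCondition : Prop := ∀ a ε b, R.rule a ε b → vars b ⊆ vars a

/-- The redex of each rule is linear. -/
def LeftLinear : Prop := ∀ a ε b, R.rule a ε b → IsLinear a

/-- `a`, `b` are the sides of a renaming of a rule of the system. -/
def IsRenamedRule (a : L.Term X) (ε : Ω) (b : L.Term X) : Prop :=
  ∃ a₀ b₀, R.rule a₀ ε b₀ ∧ AreVariants a₀ b₀ a b

/-- Renamings `ε ⊩ a ↦ b` and `δ ⊩ c ↦ d` of rules without common variables overlap at the
position of the hole of the context `C`, where `c = C[u]`: the subterm `u` of `c` is not a variable,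
it is unifiable with `a`, and if the position is the root then the rules are not variants. -/
structure Overlap (a : L.Term X) (ε : Ω) (b c : L.Term X) (δ : Ω) (d : L.Term X)
    (C : Ctx L X) (u : L.Term X) : Prop where
  left : R.IsRenamedRule a ε b
  right : R.IsRenamedRule c δ d
  disjoint : Disjoint (vars a ∪ vars b) (vars c ∪ vars d)
  decomp : c = C.fill u
  not_var : ∀ x : X, u ≠ .var x
  unifiable : ∃ σ, IsUnifier σ a u
  root : C = .hole → ¬ AreVariants a b c d

/-- `(s, t)` is a critical pair: `s = c^σ[b^σ]` and `t = d^σ` for rules `a ↦ b` and `c ↦ d` that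
overlap, where `σ` is a most general unifier. -/
def IsCriticalPair (s t : L.Term X) : Prop :=
  ∃ a ε b c δ d C u σ, R.Overlap a ε b c δ d C u ∧ IsMGU σ a u ∧
    s = (C.subst σ).fill (b.subst σ) ∧ t = d.subst σ

/-- Orthogonality: left-linear, without critical pairs. -/
def Orthogonal : Prop := R.LeftLinear ∧ ∀ s t, ¬ R.IsCriticalPair s t

end GradedTRS

end GradedRewriting

namespace GradedRewriting

universe u v w z

open FirstOrder.Language

/-! ### Ternary relations -/

section TRel

variable {Ω : Type z} [CommMonoid Ω] [CompleteLattice Ω] {A : Type w} {T : A → Ω → A → Prop}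

/-! This is the Tait–Martin-Löf method with grades. Parallel reduction `ParStep` contracts any set
of redexes, also nested ones; contracting an instance of a rule costs the grade of the rule tensored
with the grade of the steps in the substitution, weighted by the left-hand side (`substGrade`). It
lies between rewriting and its closure, so both have the same closure (`star_parStep`). It suffices
that parallel reduction is a tile: steps of grades `ε` and `δ` from one term are joined by steps of
grades `δ` and `ε`. Tiles paste into larger tiles, and a tile is a diamond because the tensor is
commutative.

Two facts give the tile (`Orthogonal.tile_parStep`). By orthogonality, a parallel step from an
instance of a non-variable left-hand side that does not contract the root acts inside the
substitution only; linearity makes the steps at the variables one substitution. By balance, steps in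
the substitution have the same grade seen through either side of a rule, so they can be postponed
until after the contraction at no loss, even if it copies or erases variables.

The induction is on the size of the term. A left-hand side may be a variable, though, and its redex
is then the whole term; these contractions are peeled off by induction on the derivation.

Finally, the tensor distributes over suprema, so confluence passes from ternary to quantale-valued
relations. -/

theorem TRel.iter_anti {n : ℕ} {a b : A} {ε δ : Ω} (h : TRel.iter T n a ε b) (hδ : δ ≤ ε) :
    TRel.iter T n a δ b := by
  cases n with
  | zero => exact ⟨h.1, hδ.trans h.2⟩
  | succ n =>
    obtain ⟨c, ε₁, ε₂, h₁, h₂, hle⟩ := h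
    exact ⟨c, ε₁, ε₂, h₁, h₂, hδ.trans hle⟩

theorem TRel.star_anti {a b : A} {ε δ : Ω} (h : TRel.star T a ε b) (hδ : δ ≤ ε) :
    TRel.star T a δ b :=
  h.imp fun _ h => TRel.iter_anti h hδ

theorem TRel.star_refl (a : A) : TRel.star T a 1 a := ⟨0, rfl, le_rfl⟩

theorem TRel.star_single {a b : A} {ε : Ω} (h : T a ε b) : TRel.star T a ε b :=
  ⟨1, b, ε, 1, h, ⟨rfl, le_rfl⟩, (mul_one ε).ge⟩

/-- A relation is a tile if it has the diamond property with the grades of opposite sides equal. -/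
def TRel.Tile (T : A → Ω → A → Prop) : Prop :=
  ∀ e ε f δ g, T e ε f → T e δ g → ∃ h, T f δ h ∧ T g ε h

theorem TRel.Tile.strip (hT : TRel.Tile T) {n : ℕ} {e f g : A} {ε δ : Ω} (hf : T e ε f)
    (hg : TRel.iter T n e δ g) : ∃ h, TRel.iter T n f δ h ∧ T g ε h := by
  induction n generalizing e f δ with
  | zero => exact ⟨f, ⟨rfl, hg.2⟩, hg.1 ▸ hf⟩
  | succ n ih =>
    obtain ⟨c, δ₁, δ₂, h₁, h₂, hle⟩ := hg
    obtain ⟨d, hd₁, hd₂⟩ := hT _ _ _ _ _ hf h₁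
    obtain ⟨h, hh₁, hh₂⟩ := ih hd₂ h₂
    exact ⟨h, ⟨d, δ₁, δ₂, hd₁, hh₁, hle⟩, hh₂⟩

/-- Rows of tiles, given by `strip`, are stacked; opposite sides of the rectangle carry the same
grades. -/
theorem TRel.Tile.iter (hT : TRel.Tile T) {m n : ℕ} {e f g : A} {ε δ : Ω}
    (hf : TRel.iter T m e ε f) (hg : TRel.iter T n e δ g) :
    ∃ h, TRel.iter T n f δ h ∧ TRel.iter T m g ε h := by
  induction m generalizing e g ε with
  | zero => exact ⟨g, hf.1 ▸ hg, rfl, hf.2⟩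
  | succ m ih =>
    obtain ⟨c, ε₁, ε₂, h₁, h₂, hle⟩ := hf
    obtain ⟨d, hd₁, hd₂⟩ := hT.strip h₁ hg
    obtain ⟨h, hh₁, hh₂⟩ := ih h₂ hd₁
    exact ⟨h, hh₁, d, ε₁, ε₂, hd₂, hh₂, hle⟩

theorem TRel.Tile.star (hT : TRel.Tile T) : TRel.Tile (TRel.star T) := by
  rintro e ε f δ g ⟨m, hf⟩ ⟨n, hg⟩
  obtain ⟨h, h₁, h₂⟩ := hT.iter hf hg
  exact ⟨h, ⟨n, h₁⟩, m, h₂⟩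

theorem TRel.Tile.diamond (hT : TRel.Tile T) : TRel.Diamond T := by
  rintro a ε b ⟨c, δ, η, h₁, h₂, hle⟩
  obtain ⟨d, hd₁, hd₂⟩ := hT _ _ _ _ _ h₁ h₂
  exact ⟨d, η, δ, hd₁, hd₂, hle.trans (mul_comm δ η).le⟩

/-! ### From ternary to quantale-valued relations -/

section Quantale

variable [IsQuantale Ω]

theorem TRel.star_trans {a b c : A} {ε δ : Ω} (h₁ : TRel.star T a ε b) (h₂ : TRel.star T b δ c) :
    TRel.star T a (ε * δ) c := by
  obtain ⟨m, h₁⟩ := h₁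
  induction m generalizing a ε with
  | zero =>
    obtain ⟨rfl, hε⟩ := h₁
    exact TRel.star_anti h₂ (mul_le_of_le_one_left' hε)
  | succ m ih =>
    obtain ⟨d, ε₁, ε₂, hd, hm, hle⟩ := h₁
    obtain ⟨n, hn⟩ := ih hm
    exact ⟨n + 1, d, ε₁, ε₂ * δ, hd, hn, (mul_le_mul_left hle δ).trans (mul_assoc _ _ _).le⟩

theorem TRel.star_of_star {S : A → Ω → A → Prop} (hST : ∀ a ε b, S a ε b → TRel.star T a ε b)
    {a b : A} {ε : Ω} (h : TRel.star S a ε b) : TRel.star T a ε b := by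
  obtain ⟨n, h⟩ := h
  induction n generalizing a ε with
  | zero => exact ⟨0, h⟩
  | succ n ih =>
    obtain ⟨c, ε₁, ε₂, h₁, h₂, hle⟩ := h
    exact TRel.star_anti (TRel.star_trans (hST _ _ _ h₁) (ih h₂)) hle

/-- The tensor distributes over suprema in both arguments, so a tensor of two suprema is the
supremum of the tensors of the witnesses. -/
theorem TRel.comp_toQRel (S T : A → Ω → A → Prop) (a c : A) :
    QRel.comp (TRel.toQRel S) (TRel.toQRel T) a c = TRel.toQRel (TRel.comp S T) a c := by
  apply le_antisymm
  · refine iSup_le fun b => ?_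
    simp only [TRel.toQRel, sSup_mul_distrib, mul_sSup_distrib]
    exact iSup₂_le fun η hη => iSup₂_le fun δ hδ => le_sSup ⟨b, δ, η, hδ, hη, le_rfl⟩
  · refine sSup_le ?_
    rintro ε ⟨b, δ, η, hδ, hη, hle⟩
    have hδ' : δ ≤ TRel.toQRel S a b := le_sSup hδ
    have hη' : η ≤ TRel.toQRel T b c := le_sSup hη
    exact hle.trans ((mul_le_mul' hδ' hη').trans
      (le_iSup (fun b => TRel.toQRel S a b * TRel.toQRel T b c) b))

theorem TRel.iter_toQRel (T : A → Ω → A → Prop) (n : ℕ) :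
    QRel.iter (TRel.toQRel T) n = TRel.toQRel (TRel.iter T n) := by
  induction n with
  | zero =>
    funext a b
    by_cases hab : a = b
    · simp only [QRel.iter, QRel.diag, TRel.toQRel, TRel.iter, TRel.diag, hab, if_true, true_and]
      exact (csSup_Iic (a := (1 : Ω))).symm
    · simp [QRel.iter, QRel.diag, TRel.toQRel, TRel.iter, TRel.diag, hab]
  | succ n ih =>
    funext a b
    rw [QRel.iter, ih, TRel.comp_toQRel, TRel.iter]

theorem TRel.star_toQRel (T : A → Ω → A → Prop) :
    QRel.star (TRel.toQRel T) = TRel.toQRel (TRel.star T) := by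
  funext a b
  simp only [QRel.star, TRel.iter_toQRel]
  apply le_antisymm
  · exact iSup_le fun n => sSup_le_sSup fun ε h => ⟨n, h⟩
  · refine sSup_le ?_
    rintro ε ⟨n, h⟩
    exact le_iSup_of_le n (le_sSup h)

theorem TRel.Diamond.toQRel (hT : TRel.Diamond T) : QRel.Diamond (TRel.toQRel T) := by
  intro a b
  change QRel.comp (TRel.toQRel (TRel.dual T)) (TRel.toQRel T) a b ≤
    QRel.comp (TRel.toQRel T) (TRel.toQRel (TRel.dual T)) a b
  rw [TRel.comp_toQRel, TRel.comp_toQRel]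
  exact sSup_le_sSup fun ε h => hT _ _ _ h

theorem TRel.Confluent.toQRel (hT : TRel.Confluent T) : QRel.Confluent (TRel.toQRel T) := by
  rw [QRel.Confluent, TRel.star_toQRel]
  exact TRel.Diamond.toQRel hT

end Quantale

end TRel

/-! ### Terms and contexts -/

section Terms

variable {L : FirstOrder.Language.{u, v}} {X : Type w}

@[simp]
theorem mem_vars_var {x y : X} : x ∈ vars (Term.var y : L.Term X) ↔ x = y := by
  simp [vars]

@[simp]
theorem mem_vars_func {n : ℕ} {f : L.Functions n} {ts : Fin n → L.Term X} {x : X} :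
    x ∈ vars (Term.func f ts) ↔ ∃ i, x ∈ vars (ts i) := by
  simp [vars]

theorem finite_vars (t : L.Term X) : (vars t).Finite := Finset.finite_toSet _

theorem subst_congr {t : L.Term X} {σ τ : X → L.Term X} (h : ∀ x ∈ vars t, σ x = τ x) :
    t.subst σ = t.subst τ := by
  induction t with
  | var x => exact h x (by simp)
  | func f ts ih =>
    simp only [Term.subst, Term.func.injEq, heq_eq_eq, true_and]
    exact funext fun i => ih i fun x hx => h x (mem_vars_func.2 ⟨i, hx⟩)

theorem eq_of_subst_eq {t : L.Term X} {σ τ : X → L.Term X} (h : t.subst σ = t.subst τ) :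
    ∀ x ∈ vars t, σ x = τ x := by
  induction t with
  | var x => simpa using h
  | func f ts ih =>
    simp only [Term.subst, Term.func.injEq, heq_eq_eq, true_and] at h
    intro x hx
    obtain ⟨i, hi⟩ := mem_vars_func.1 hx
    exact ih i (congrFun h i) x hi

theorem subst_var (t : L.Term X) : t.subst Term.var = t := by
  induction t with
  | var x => rfl
  | func f ts ih => simp [ih]

theorem relabel_eq_subst (t : L.Term X) (ρ : X → X) :
    t.relabel ρ = t.subst fun x => Term.var (ρ x) := by
  induction t with
  | var x => rfl
  | func f ts ih => simp [ih]

theorem subst_relabel (t : L.Term X) (ρ : X → X) (σ : X → L.Term X) :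
    (t.relabel ρ).subst σ = t.subst (σ ∘ ρ) := by
  induction t with
  | var x => rfl
  | func f ts ih => simp [ih]

theorem vars_relabel (t : L.Term X) (ρ : X → X) : vars (t.relabel ρ) = ρ '' vars t := by
  induction t with
  | var x => ext; simp [eq_comm]
  | func f ts ih =>
    ext y
    simp only [Term.relabel, mem_vars_func, ih, Set.mem_image]
    tauto

theorem relabel_injective (ρ : Equiv.Perm X) :
    Function.Injective (Term.relabel ρ : L.Term X → L.Term X) :=
  (Term.relabelEquiv ρ).injective

theorem occ_relabel (t : L.Term X) (ρ : Equiv.Perm X) (x : X) :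
    occ (ρ x) (t.relabel ρ) = occ x t := by
  induction t with
  | var y => by_cases h : y = x <;> simp [occ, h]
  | func f ts ih => simp [occ, ih]

theorem occ_pos {t : L.Term X} {x : X} : 0 < occ x t ↔ x ∈ vars t := by
  induction t with
  | var y => by_cases h : x = y <;> simp [occ, h, eq_comm]
  | func f ts ih => simp [occ, Finset.sum_pos_iff, ih]

theorem IsLinear.relabel {t : L.Term X} (h : IsLinear t) (ρ : Equiv.Perm X) :
    IsLinear (t.relabel ρ) := fun x => by
  rw [← ρ.apply_symm_apply x, occ_relabel]
  exact h _

theorem IsLinear.arg {n : ℕ} {f : L.Functions n} {ts : Fin n → L.Term X}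
    (h : IsLinear (Term.func f ts)) (i : Fin n) : IsLinear (ts i) := fun x =>
  (Finset.single_le_sum (f := fun i => occ x (ts i)) (fun _ _ => Nat.zero_le _)
    (Finset.mem_univ i)).trans (h x)

theorem IsLinear.eq_of_mem {n : ℕ} {f : L.Functions n} {ts : Fin n → L.Term X}
    (h : IsLinear (Term.func f ts)) {i j : Fin n} {x : X} (hi : x ∈ vars (ts i))
    (hj : x ∈ vars (ts j)) : i = j := by
  by_contra hij
  have h₁ : ∑ k ∈ {i, j}, occ x (ts k) ≤ ∑ k, occ x (ts k) :=
    Finset.sum_le_sum_of_subset (Finset.subset_univ _)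
  rw [Finset.sum_pair hij] at h₁
  have h₂ : ∑ k, occ x (ts k) ≤ 1 := h x
  have := occ_pos.2 hi
  have := occ_pos.2 hj
  omega

/-- A family of functions on the variables of the arguments of a linear term can be glued. -/
theorem IsLinear.exists_glue {n : ℕ} {f : L.Functions n} {ts : Fin n → L.Term X}
    (h : IsLinear (Term.func f ts)) {B : Type*} (g : Fin n → X → B) (g₀ : X → B) :
    ∃ G : X → B, (∀ i, ∀ x ∈ vars (ts i), G x = g i x) ∧
      ∀ x ∉ vars (Term.func f ts), G x = g₀ x := by
  classical
  refine ⟨fun x => if hx : ∃ i, x ∈ vars (ts i) then g hx.choose x else g₀ x, ?_, ?_⟩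
  · intro i x hi
    have hx : ∃ i, x ∈ vars (ts i) := ⟨i, hi⟩
    simp only [dif_pos hx]
    rw [h.eq_of_mem hx.choose_spec hi]
  · intro x hx
    rw [mem_vars_func] at hx
    simp [hx]

theorem vars_subset_vars_fill (C : Ctx L X) (t : L.Term X) : vars t ⊆ vars (C.fill t) := by
  induction C with
  | hole => exact subset_rfl
  | func f i ts C ih => exact fun x hx => mem_vars_func.2 ⟨i, by simpa using ih hx⟩

theorem IsLinear.of_fill {C : Ctx L X} {t : L.Term X} (h : IsLinear (C.fill t)) : IsLinear t := by
  induction C with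
  | hole => exact h
  | func f i ts C ih => exact ih (by simpa using h.arg i)

theorem subst_fill (C : Ctx L X) (t : L.Term X) (σ : X → L.Term X) :
    (C.fill t).subst σ = (C.subst σ).fill (t.subst σ) := by
  induction C with
  | hole => rfl
  | func f i ts C ih =>
    simp only [Ctx.fill, Ctx.subst, Term.subst, Term.func.injEq, heq_eq_eq, true_and]
    funext j
    by_cases hj : j = i
    · subst hj; simp [ih]
    · simp [hj]

theorem Ctx.subst_eq_hole {C : Ctx L X} {σ : X → L.Term X} : C.subst σ = .hole ↔ C = .hole := by
  cases C <;> simp [Ctx.subst]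

/-- Composition of contexts: `(C.comp D)[t] = C[D[t]]`. -/
def Ctx.comp : Ctx L X → Ctx L X → Ctx L X
  | .hole, D => D
  | .func f i ts C, D => .func f i ts (C.comp D)

theorem Ctx.fill_comp (C D : Ctx L X) (t : L.Term X) : (C.comp D).fill t = C.fill (D.fill t) := by
  induction C with
  | hole => rfl
  | func f i ts C ih => simp [Ctx.comp, Ctx.fill, ih]

theorem Ctx.comp_func_ne_hole (C : Ctx L X) {n : ℕ} (f : L.Functions n) (i : Fin n)
    (ts : Fin n → L.Term X) (D : Ctx L X) : C.comp (.func f i ts D) ≠ .hole := by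
  cases C <;> simp [Ctx.comp]

/-- The number of function symbols in a term. -/
def termSize : L.Term X → ℕ
  | .var _ => 0
  | .func _ ts => (∑ i, termSize (ts i)) + 1

theorem termSize_arg_lt {n : ℕ} (f : L.Functions n) (ts : Fin n → L.Term X) (i : Fin n) :
    termSize (ts i) < termSize (Term.func f ts) :=
  Nat.lt_succ_of_le (Finset.single_le_sum (f := fun i => termSize (ts i))
    (fun _ _ => Nat.zero_le _) (Finset.mem_univ i))

theorem termSize_le_subst {t : L.Term X} {x : X} (hx : x ∈ vars t) (σ : X → L.Term X) :
    termSize (σ x) ≤ termSize (t.subst σ) := by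
  induction t with
  | var y => rw [mem_vars_var] at hx; simp [hx]
  | func f ts ih =>
    obtain ⟨i, hi⟩ := mem_vars_func.1 hx
    exact (ih i hi).trans (termSize_arg_lt f (fun i => (ts i).subst σ) i).le

/-- This decrease drives the induction on size; for a variable left-hand side the two sizes are
equal. -/
theorem termSize_lt_subst {t : L.Term X} (ht : ∀ x, t ≠ Term.var x) {x : X} (hx : x ∈ vars t)
    (σ : X → L.Term X) : termSize (σ x) < termSize (t.subst σ) := by
  cases t with
  | var y => exact absurd rfl (ht y)
  | func f ts =>
    obtain ⟨i, hi⟩ := mem_vars_func.1 hx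
    exact (termSize_le_subst hi σ).trans_lt (termSize_arg_lt f (fun i => (ts i).subst σ) i)

/-! ### Unification of linear terms without common variables -/

/-- Unifiable linear terms without common variables have a most general unifier `σ` such that
every unifier `τ` is `σ` followed by `τ`. -/
theorem exists_mgu {s t : L.Term X} (hs : IsLinear s) (ht : IsLinear t)
    (hst : Disjoint (vars s) (vars t)) (h : ∃ τ, IsUnifier τ s t) :
    ∃ σ, IsUnifier σ s t ∧ ∀ τ, IsUnifier τ s t → ∀ x, τ x = (σ x).subst τ := by
  classical
  induction s generalizing t with
  | var x =>
    refine ⟨Function.update Term.var x t, ?_, ?_⟩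
    · have hx : x ∉ vars t := Set.disjoint_left.1 hst (by simp)
      have := subst_congr (t := t) (σ := Function.update Term.var x t) (τ := Term.var)
        fun y hy => Function.update_of_ne (fun e => hx (by rwa [← e])) _ _
      simp [IsUnifier, this, subst_var]
    · intro τ hτ y
      by_cases hy : y = x
      · subst hy; simpa [IsUnifier] using hτ
      · simp [hy]
  | func f ss ih =>
    cases t with
    | var x =>
      refine ⟨Function.update Term.var x (Term.func f ss), ?_, ?_⟩
      · have hx : x ∉ vars (Term.func f ss) := Set.disjoint_right.1 hst (by simp)
        have := subst_congr (t := Term.func f ss)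
          (σ := Function.update Term.var x (Term.func f ss)) (τ := Term.var)
          fun y hy => Function.update_of_ne (fun e => hx (by rwa [← e])) _ _
        rw [subst_var] at this
        rw [IsUnifier, this]
        simp
      · intro τ hτ y
        by_cases hy : y = x
        · subst hy; simpa [IsUnifier] using hτ.symm
        · simp [hy]
    | func g ts =>
      obtain ⟨τ₀, hτ₀⟩ := h
      simp only [IsUnifier, Term.subst, Term.func.injEq] at hτ₀
      obtain ⟨rfl, hfg, hargs⟩ := hτ₀
      obtain rfl := eq_of_heq hfg
      have hargs := congrFun (eq_of_heq hargs)
      have hdisj : ∀ i, ∀ x ∈ vars (ts i), x ∉ vars (Term.func f ss) := fun i x hx =>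
        Set.disjoint_right.1 hst (mem_vars_func.2 ⟨i, hx⟩)
      -- Each unifier `τ` factors through every `σ i` by `τ` itself, so the factorizations agree and
      -- survive gluing.
      choose σ hσ hσ' using fun i => ih i (hs.arg i) (ht.arg i)
        (Set.disjoint_left.2 fun x hx hx' => hdisj i x hx' (mem_vars_func.2 ⟨i, hx⟩))
        ⟨τ₀, hargs i⟩
      obtain ⟨G₀, hG₀, hG₀'⟩ := ht.exists_glue σ Term.var
      obtain ⟨G, hG, hG'⟩ := hs.exists_glue σ G₀
      have hGt : ∀ i, ∀ x ∈ vars (ts i), G x = σ i x := fun i x hx =>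
        (hG' x (hdisj i x hx)).trans (hG₀ i x hx)
      refine ⟨G, ?_, ?_⟩
      · simp only [IsUnifier, Term.subst, Term.func.injEq, heq_eq_eq, true_and]
        funext i
        rw [subst_congr (hG i), subst_congr (hGt i)]
        exact hσ i
      · intro τ hτ x
        simp only [IsUnifier, Term.subst, Term.func.injEq, heq_eq_eq, true_and] at hτ
        by_cases hx : x ∈ vars (Term.func f ss)
        · obtain ⟨i, hi⟩ := mem_vars_func.1 hx
          rw [hG i x hi]
          exact hσ' i τ (congrFun hτ i) x
        · rw [hG' x hx]
          by_cases hx' : x ∈ vars (Term.func f ts)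
          · obtain ⟨i, hi⟩ := mem_vars_func.1 hx'
            rw [hG₀ i x hi]
            exact hσ' i τ (congrFun hτ i) x
          · rw [hG₀' x hx']
            rfl

/-- The variables of a finite set can be renamed so as to avoid another finite set. -/
theorem exists_perm_avoiding [Infinite X] {A B : Set X} (hA : A.Finite) (hB : B.Finite) :
    ∃ ρ : Equiv.Perm X, ∀ x ∈ B, ρ x ∉ A := by
  classical
  induction B, hB using Set.Finite.induction_on with
  | empty => exact ⟨1, by simp⟩
  | @insert b B hb hB ih =>
    obtain ⟨ρ, hρ⟩ := ih
    -- As `y` avoids `ρ '' B`, swapping `ρ b` with `y` moves no image of `B`.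
    obtain ⟨y, hy⟩ := ((hA.union (hB.image ρ)).insert (ρ b)).exists_notMem
    simp only [Set.mem_insert_iff, Set.mem_union, not_or] at hy
    refine ⟨ρ.trans (Equiv.swap (ρ b) y), ?_⟩
    rintro x (rfl | hx)
    · simpa using hy.2.1
    · have h₁ : ρ x ≠ ρ b := fun e => hb (ρ.injective e ▸ hx)
      have h₂ : ρ x ≠ y := fun e => hy.2.2 ⟨x, hx, e⟩
      simpa [Equiv.swap_apply_of_ne_of_ne h₁ h₂] using hρ x hx

end Terms

namespace IsCBE

variable {Ω : Type z} [CommMonoid Ω] [CompleteLattice Ω] {φ : Ω → Ω}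

theorem map_prod (hφ : IsCBE φ) {ι : Type*} (s : Finset ι) (g : ι → Ω) :
    φ (∏ i ∈ s, g i) = ∏ i ∈ s, φ (g i) :=
  _root_.map_prod (⟨⟨φ, hφ.map_one⟩, hφ.map_mul⟩ : Ω →* Ω) g s

end IsCBE

theorem LawvereanQuantale.le_one {Ω : Type z} [CommMonoid Ω] [CompleteLattice Ω]
    [LawvereanQuantale Ω] (ε : Ω) : ε ≤ 1 := by
  rw [LawvereanQuantale.one_eq_top]
  exact le_top

namespace GradedTRS

variable {Ω : Type z} [CommMonoid Ω] [CompleteLattice Ω] {Φ : GradeStructure Ω}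
  {L : FirstOrder.Language.{u, v}} {X : Type w} {R : GradedTRS Φ L X}

theorem isCBE_grade {n : ℕ} (f : L.Functions n) (i : Fin n) : IsCBE (R.grade f i) :=
  Φ.isCBE _ (R.grade_mem f i)

/-! ### The grade of a substitution in a term -/

variable (R) in
/-- The grade of a term after assigning grades to its variables. -/
def substGrade (η : X → Ω) : L.Term X → Ω
  | .var x => η x
  | .func f ts => ∏ i, R.grade f i (substGrade η (ts i))

theorem substGrade_congr {η θ : X → Ω} {t : L.Term X} (h : ∀ x ∈ vars t, η x = θ x) :
    R.substGrade η t = R.substGrade θ t := by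
  induction t with
  | var x => exact h x (by simp)
  | func f ts ih =>
    exact Finset.prod_congr rfl fun i _ => congrArg _
      (ih i fun x hx => h x (mem_vars_func.2 ⟨i, hx⟩))

theorem substGrade_relabel (η : X → Ω) (t : L.Term X) (ρ : X → X) :
    R.substGrade η (t.relabel ρ) = R.substGrade (η ∘ ρ) t := by
  induction t with
  | var x => rfl
  | func f ts ih => simp only [Term.relabel, substGrade, ih]

theorem deg_of_notMem {x : X} {t : L.Term X} (hx : x ∉ vars t) (ε : Ω) : R.deg x t ε = 1 := by
  induction t with
  | var y =>
    rw [mem_vars_var] at hx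
    simp [deg, Ne.symm hx]
  | func f ts ih =>
    refine Finset.prod_eq_one fun i _ => ?_
    rw [ih i fun hi => hx (mem_vars_func.2 ⟨i, hi⟩), (isCBE_grade f i).map_one]

/-- Grades preserve finite tensors, so the contributions of the variables separate. Variables of `s`
outside `t` contribute `1`; hence the two sides of a rule can be compared over one index set. -/
theorem substGrade_eq_prod_deg (η : X → Ω) {t : L.Term X} {s : Finset X} (hs : vars t ⊆ s) :
    R.substGrade η t = ∏ x ∈ s, R.deg x t (η x) := by
  induction t with
  | var y =>
    rw [Finset.prod_eq_single_of_mem y (hs (by simp))]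
    · simp [deg, substGrade]
    · intro x _ hx
      exact deg_of_notMem (by simpa using hx) _
  | func f ts ih =>
    simp only [deg, substGrade]
    rw [Finset.prod_comm]
    refine Finset.prod_congr rfl fun i _ => ?_
    rw [ih i fun x hx => hs (mem_vars_func.2 ⟨i, hx⟩), (isCBE_grade f i).map_prod]

theorem Balanced.substGrade_eq (hbal : R.Balanced) {a b : L.Term X} {ε : Ω} (h : R.rule a ε b)
    (η : X → Ω) : R.substGrade η a = R.substGrade η b := by
  classical
  have hs := ((finite_vars a).union (finite_vars b)).coe_toFinset
  rw [substGrade_eq_prod_deg η (Set.subset_union_left.trans hs.ge),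
    substGrade_eq_prod_deg η (Set.subset_union_right.trans hs.ge)]
  exact Finset.prod_congr rfl fun x _ => by rw [hbal a ε b h x]

/-! ### Overlaps -/

/-- In an orthogonal system, a redex occurs at a non-variable position of a left-hand side only
if the position is the root and the rules are variants. -/
theorem Orthogonal.areVariants [Infinite X] (horth : R.Orthogonal) {a b c d u : L.Term X}
    {ε δ : Ω} {C : Ctx L X} {σ τ : X → L.Term X} (hab : R.rule a ε b) (hcd : R.rule c δ d)
    (hC : c = C.fill u) (hu : ∀ x, u ≠ .var x) (h : a.subst σ = u.subst τ) :
    C = .hole ∧ AreVariants a b c d := by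
  classical
  -- Critical pairs are formed from rules without common variables, so the second rule is renamed;
  -- `σ` and `τ` then merge into one unifier.
  obtain ⟨ρ, hρ⟩ := exists_perm_avoiding ((finite_vars a).union (finite_vars b))
    ((finite_vars c).union (finite_vars d))
  have hdisj : Disjoint (vars a ∪ vars b) (vars (c.relabel ρ) ∪ vars (d.relabel ρ)) := by
    rw [vars_relabel, vars_relabel, ← Set.image_union, Set.disjoint_right]
    rintro _ ⟨x, hx, rfl⟩
    exact hρ x hx
  have hcu : c.relabel ρ = (C.subst fun x => .var (ρ x)).fill (u.relabel ρ) := by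
    rw [relabel_eq_subst, relabel_eq_subst, hC, subst_fill]
  have huc : vars (u.relabel ρ) ⊆ vars (c.relabel ρ) := hcu ▸ vars_subset_vars_fill _ _
  have hunif : ∃ τ, IsUnifier τ a (u.relabel ρ) := by
    refine ⟨fun x => if x ∈ vars a then σ x else τ (ρ.symm x), ?_⟩
    rw [IsUnifier, subst_congr (τ := σ) fun x hx => if_pos hx, h, subst_relabel]
    refine subst_congr fun x hx => ?_
    have : ρ x ∉ vars a := fun hx' => hρ x
      (Or.inl (hC ▸ vars_subset_vars_fill C u hx)) (Or.inl hx')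
    simp [this]
  by_contra hcon
  have hover : R.Overlap a ε b (c.relabel ρ) δ (d.relabel ρ) (C.subst fun x => .var (ρ x))
      (u.relabel ρ) :=
    { left := ⟨a, b, hab, 1, Term.relabel_id a, Term.relabel_id b⟩
      right := ⟨c, d, hcd, ρ, rfl, rfl⟩
      disjoint := hdisj
      decomp := hcu
      not_var := fun x hx => by
        cases u with
        | var y => exact hu y rfl
        | func f ts => simp at hx
      unifiable := hunif
      root := by
        rintro hhole ⟨π, hπ₁, hπ₂⟩
        refine hcon ⟨Ctx.subst_eq_hole.1 hhole, π.trans ρ.symm, ?_, ?_⟩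
        · apply relabel_injective ρ
          rw [← hπ₁, Term.relabel_relabel]
          congr 1
          funext x
          simp
        · apply relabel_injective ρ
          rw [← hπ₂, Term.relabel_relabel]
          congr 1
          funext x
          simp }
  have hlin : IsLinear u := (hC ▸ horth.1 c δ d hcd : IsLinear (C.fill u)).of_fill
  obtain ⟨μ, hμ, hμ'⟩ := exists_mgu (horth.1 a ε b hab) (hlin.relabel ρ)
    (hdisj.mono Set.subset_union_left (huc.trans Set.subset_union_left)) hunif
  exact horth.2 _ _ ⟨a, ε, b, _, δ, _, _, _, μ, hover, ⟨hμ, fun τ hτ => ⟨τ, hμ' τ hτ⟩⟩, rfl, rfl⟩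

/-! ### Parallel reduction -/

variable (R) in
/-- Parallel reduction: simultaneous contraction of redexes, also nested ones. -/
inductive ParStep : L.Term X → Ω → L.Term X → Prop
  | var (x : X) (ε : Ω) : ParStep (.var x) ε (.var x)
  | func {n : ℕ} (f : L.Functions n) {ts ts' : Fin n → L.Term X} (η : Fin n → Ω) {ε : Ω} :
      (∀ i, ParStep (ts i) (η i) (ts' i)) → ε ≤ ∏ i, R.grade f i (η i) →
      ParStep (.func f ts) ε (.func f ts')
  | root {a b : L.Term X} {ε₀ ε : Ω} (σ σ' : X → L.Term X) (η : X → Ω) : R.rule a ε₀ b →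
      (∀ x ∈ vars a, ParStep (σ x) (η x) (σ' x)) → ε ≤ ε₀ * R.substGrade η a →
      ParStep (a.subst σ) ε (b.subst σ')

theorem ParStep.anti {e f : L.Term X} {ε δ : Ω} (h : R.ParStep e ε f) (hδ : δ ≤ ε) :
    R.ParStep e δ f := by
  cases h with
  | var x => exact .var x δ
  | func f η h hle => exact .func f η h (hδ.trans hle)
  | root σ σ' η hr h hle => exact .root σ σ' η hr h (hδ.trans hle)

variable (R) in
/-- The results of two parallel steps can be joined by steps with the grades exchanged. -/
def Joinable (f : L.Term X) (ε : Ω) (g : L.Term X) (δ : Ω) : Prop :=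
  ∃ h, R.ParStep f δ h ∧ R.ParStep g ε h

theorem Joinable.symm {f g : L.Term X} {ε δ : Ω} (h : R.Joinable f ε g δ) : R.Joinable g δ f ε :=
  h.imp fun _ h => h.symm
-- All copies of a variable are reduced in one parallel step, so `t` need not be linear; this is
-- used for contracta.
theorem ParStep.subst {t : L.Term X} {σ σ' : X → L.Term X} {η : X → Ω}
    (h : ∀ x ∈ vars t, R.ParStep (σ x) (η x) (σ' x)) :
    R.ParStep (t.subst σ) (R.substGrade η t) (t.subst σ') := by
  induction t with
  | var x => exact h x (by simp)
  | func f ts ih =>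
    exact .func f _ (fun i => ih i fun x hx => h x (mem_vars_func.2 ⟨i, hx⟩)) le_rfl

/-! ### Rewriting and parallel reduction have the same closure -/

theorem Step.arg {n : ℕ} (f : L.Functions n) (i : Fin n) (ts : Fin n → L.Term X)
    {e e' : L.Term X} {ε : Ω} (h : R.Step e ε e') :
    R.Step (.func f (Function.update ts i e)) (R.grade f i ε)
      (.func f (Function.update ts i e')) := by
  induction h with
  | rule C σ hr => exact .rule (.func f i ts C) σ hr
  | weaken _ hle ih => exact .weaken ih ((isCBE_grade f i).monotone hle)

section Quantale

variable [LawvereanQuantale Ω]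

/-- With every argument idle at grade `1` the product is `1`, and integrality allows any smaller
grade. -/
theorem ParStep.refl (e : L.Term X) (ε : Ω) : R.ParStep e ε e := by
  induction e generalizing ε with
  | var x => exact .var x ε
  | func f ts ih =>
    refine .func f (fun _ => 1) (fun i => ih i 1) ?_
    simpa [(isCBE_grade f _).map_one] using LawvereanQuantale.le_one ε

theorem ParStep.fill (C : Ctx L X) {e f : L.Term X} {ε : Ω} (h : R.ParStep e ε f) :
    R.ParStep (C.fill e) (R.degCtx C ε) (C.fill f) := by
  classical
  induction C with
  | hole => exact h
  | func g i ts C ih =>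
    refine .func g (Function.update (fun _ => 1) i (R.degCtx C ε)) (fun j => ?_) ?_
    · by_cases hj : j = i
      · subst hj; simpa using ih
      · simpa [hj] using ParStep.refl _ _
    · rw [Finset.prod_eq_single_of_mem i (Finset.mem_univ i)]
      · simp [degCtx]
      · intro j _ hj
        simp [hj, (isCBE_grade g j).map_one]

theorem Step.parStep {e f : L.Term X} {ε : Ω} (h : R.Step e ε f) : R.ParStep e ε f := by
  induction h with
  | @rule a ε b C σ hr =>
    refine ParStep.fill C (.root σ σ (fun _ => 1) hr (fun x _ => .refl _ _) ?_)
    suffices R.substGrade (fun _ => 1) a = 1 by rw [this, mul_one]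
    clear hr
    induction a with
    | var x => rfl
    | func f ts ih =>
      exact Finset.prod_eq_one fun i _ => by rw [ih i, (isCBE_grade f i).map_one]
  | weaken _ hle ih => exact ih.anti hle

/-- Since grades preserve the tensor, the cost of a reduction sequence passes under `f` without
loss. -/
theorem star_arg {n : ℕ} (f : L.Functions n) (i : Fin n) (ts : Fin n → L.Term X)
    {e e' : L.Term X} {ε : Ω} (h : TRel.star R.Step e ε e') :
    TRel.star R.Step (.func f (Function.update ts i e)) (R.grade f i ε)
      (.func f (Function.update ts i e')) := by
  obtain ⟨n, h⟩ := h
  induction n generalizing e ε with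
  | zero =>
    obtain ⟨rfl, -⟩ := h
    exact TRel.star_anti (TRel.star_refl _) (LawvereanQuantale.le_one _)
  | succ n ih =>
    obtain ⟨c, ε₁, ε₂, h₁, h₂, hle⟩ := h
    refine TRel.star_anti (TRel.star_trans (TRel.star_single (h₁.arg f i ts)) (ih h₂)) ?_
    rw [← (isCBE_grade f i).map_mul]
    exact (isCBE_grade f i).monotone hle

theorem star_args {n : ℕ} (f : L.Functions n) {ts ts' : Fin n → L.Term X} {η : Fin n → Ω}
    (h : ∀ i, TRel.star R.Step (ts i) (η i) (ts' i)) :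
    TRel.star R.Step (.func f ts) (∏ i, R.grade f i (η i)) (.func f ts') := by
  classical
  -- The arguments with index in `s` have been reduced, one after the other.
  have key : ∀ s : Finset (Fin n), TRel.star R.Step (.func f ts) (∏ i ∈ s, R.grade f i (η i))
      (.func f (s.piecewise ts' ts)) := by
    intro s
    induction s using Finset.induction_on with
    | empty => simpa using TRel.star_refl _
    | insert i s hi ih =>
      rw [Finset.prod_insert hi, mul_comm, Finset.piecewise_insert]
      refine TRel.star_trans ih ?_
      have := star_arg f i (s.piecewise ts' ts) (h i)
      rwa [show Function.update (s.piecewise ts' ts) i (ts i) = s.piecewise ts' ts from by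
        simp [Function.update_eq_self_iff, hi]] at this
  simpa using key Finset.univ

theorem star_subst {t : L.Term X} {σ σ' : X → L.Term X} {η : X → Ω}
    (h : ∀ x ∈ vars t, TRel.star R.Step (σ x) (η x) (σ' x)) :
    TRel.star R.Step (t.subst σ) (R.substGrade η t) (t.subst σ') := by
  induction t with
  | var x => exact h x (by simp)
  | func f ts ih =>
    exact star_args f fun i => ih i fun x hx => h x (mem_vars_func.2 ⟨i, hx⟩)

theorem ParStep.star_step {e f : L.Term X} {ε : Ω} (h : R.ParStep e ε f) :
    TRel.star R.Step e ε f := by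
  induction h with
  | var x ε => exact TRel.star_anti (TRel.star_refl _) (LawvereanQuantale.le_one _)
  | func f η _ hle ih => exact TRel.star_anti (star_args f ih) hle
  | root σ σ' η hr _ hle ih =>
    -- The substitution is reduced first and the root redex contracted last.
    refine TRel.star_anti (TRel.star_trans (star_subst ih)
      (TRel.star_single (Step.rule .hole σ' hr))) ?_
    exact hle.trans (mul_comm _ _).le

theorem star_parStep : TRel.star R.ParStep = TRel.star R.Step := by
  funext e ε f
  exact propext ⟨TRel.star_of_star fun _ _ _ h => h.star_step,
    TRel.star_of_star fun _ _ _ h => TRel.star_single h.parStep⟩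

/-- Steps in the arguments of an instance of a linear term that are steps of the substitution
combine to a step of the substitution. -/
theorem exists_subst_of_args {n : ℕ} {f : L.Functions n} {ts ts' : Fin n → L.Term X}
    (hlin : IsLinear (Term.func f ts)) {σ : X → L.Term X} {θ : Fin n → Ω} {ε : Ω}
    (h : ∀ i, ∃ σ' η, ts' i = (ts i).subst σ' ∧
      (∀ x ∈ vars (ts i), R.ParStep (σ x) (η x) (σ' x)) ∧ θ i ≤ R.substGrade η (ts i))
    (hle : ε ≤ ∏ i, R.grade f i (θ i)) :
    ∃ σ' η, Term.func f ts' = (Term.func f ts).subst σ' ∧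
      (∀ x ∈ vars (Term.func f ts), R.ParStep (σ x) (η x) (σ' x)) ∧
      ε ≤ R.substGrade η (Term.func f ts) := by
  choose σ' η h₁ h₂ h₃ using h
  obtain ⟨G, hG, -⟩ := hlin.exists_glue σ' Term.var
  obtain ⟨H, hH, -⟩ := hlin.exists_glue η fun _ => 1
  refine ⟨G, H, ?_, ?_, hle.trans ?_⟩
  · simp only [Term.subst, Term.func.injEq, heq_eq_eq, true_and]
    funext i
    rw [h₁ i, subst_congr (hG i)]
  · intro x hx
    obtain ⟨i, hi⟩ := mem_vars_func.1 hx
    rw [hG i x hi, hH i x hi]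
    exact h₂ i x hi
  · refine Finset.prod_le_prod' fun i _ => (isCBE_grade f i).monotone ?_
    rw [substGrade_congr (hH i)]
    exact h₃ i

end Quantale

/-! ### Parallel steps from instances of left-hand sides -/

section Overlap

variable [LawvereanQuantale Ω] [Infinite X]

/-- A contraction at the root of a non-variable `u` would be an overlap strictly inside `c`. So the
step descends through the function symbols of `u` until it reaches the variables, where linearity
glues the results. -/
theorem Orthogonal.exists_subst_of_parStep (horth : R.Orthogonal) {c d : L.Term X} {δ : Ω}
    (hcd : R.rule c δ d) {u : L.Term X} {C : Ctx L X} (hC : c = C.fill u) (hhole : C ≠ .hole)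
    {σ : X → L.Term X} {ε : Ω} {e : L.Term X} (h : R.ParStep (u.subst σ) ε e) :
    ∃ σ' η, e = u.subst σ' ∧ (∀ x ∈ vars u, R.ParStep (σ x) (η x) (σ' x)) ∧
      ε ≤ R.substGrade η u := by
  induction u generalizing C ε e with
  | var x =>
    refine ⟨fun _ => e, fun _ => ε, rfl, fun y hy => ?_, le_rfl⟩
    rw [mem_vars_var.1 hy]
    exact h
  | func f ts ih =>
    have hlin : IsLinear (Term.func f ts) :=
      (hC ▸ horth.1 c δ d hcd : IsLinear (C.fill (Term.func f ts))).of_fill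
    generalize hs : (Term.func f ts).subst σ = s at h
    cases h with
    | var x => simp at hs
    | root τ τ' η hr _ _ =>
      exact absurd (horth.areVariants hr hcd hC (by simp) hs.symm).1 hhole
    | func g θ h hle =>
      simp only [Term.subst, Term.func.injEq] at hs
      obtain ⟨rfl, hfg, hargs⟩ := hs
      obtain rfl := eq_of_heq hfg
      obtain rfl := eq_of_heq hargs
      refine exists_subst_of_args hlin (fun i => ?_) hle
      refine ih i (C := C.comp (.func f i ts .hole)) ?_ (Ctx.comp_func_ne_hole _ _ _ _ _) (h i)
      rw [Ctx.fill_comp, hC]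
      simp [Ctx.fill]

/-- The root is not contracted and each argument lies strictly inside `c`, so the steps in the
arguments all act in the substitution. -/
theorem Orthogonal.exists_subst_of_args (horth : R.Orthogonal) {c d : L.Term X} {δ : Ω}
    (hcd : R.rule c δ d) (hc : ∀ x, c ≠ .var x) {σ : X → L.Term X} {n : ℕ} {f : L.Functions n}
    {ts ts' : Fin n → L.Term X} {θ : Fin n → Ω} {ε : Ω} (hs : .func f ts = c.subst σ)
    (h : ∀ i, R.ParStep (ts i) (θ i) (ts' i)) (hle : ε ≤ ∏ i, R.grade f i (θ i)) :
    ∃ σ' η, .func f ts' = c.subst σ' ∧ (∀ x ∈ vars c, R.ParStep (σ x) (η x) (σ' x)) ∧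
      ε ≤ R.substGrade η c := by
  cases c with
  | var x => exact absurd rfl (hc x)
  | func g ss =>
    simp only [Term.subst, Term.func.injEq] at hs
    obtain ⟨rfl, hfg, hargs⟩ := hs
    obtain rfl := eq_of_heq hfg
    obtain rfl := eq_of_heq hargs
    refine GradedTRS.exists_subst_of_args (horth.1 _ δ d hcd) (fun i => ?_) hle
    exact horth.exists_subst_of_parStep hcd (C := .func f i ss .hole) (by simp [Ctx.fill])
      (by simp) (h i)

end Overlap

/-! ### The tiling property of parallel reduction -/

/-! ### The tiling property of parallel reduction -/

/-- Both results reduce to `b.subst τ`, with `τ` joining `σ₁` and `σ₂`. Balance gives the residual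
steps in `b` the grade that they had in `a`. -/
theorem joinable_root_subst [LawvereanQuantale Ω] (hbal : R.Balanced)
    (hvar : R.VariableCondition) {a b : L.Term X} {ε₀ ε δ : Ω}
    (hr : R.rule a ε₀ b) {σ₁ σ₂ : X → L.Term X} {η₁ η₂ : X → Ω}
    (h : ∀ x ∈ vars a, R.Joinable (σ₁ x) (η₁ x) (σ₂ x) (η₂ x))
    (hε : ε ≤ ε₀ * R.substGrade η₁ a) (hδ : δ ≤ R.substGrade η₂ a) :
    R.Joinable (b.subst σ₁) ε (a.subst σ₂) δ := by
  have : ∀ x, ∃ t, x ∈ vars a → R.ParStep (σ₁ x) (η₂ x) t ∧ R.ParStep (σ₂ x) (η₁ x) t := by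
    intro x
    by_cases hx : x ∈ vars a
    · exact (h x hx).imp fun _ ht _ => ht
    -- The value outside `vars a` is arbitrary: the variable condition keeps such variables out of
    -- `b`.
    · exact ⟨.var x, fun hx' => absurd hx' hx⟩
  choose τ hτ using this
  refine ⟨b.subst τ, ?_, .root σ₂ τ η₁ hr (fun x hx => (hτ x hx).2) hε⟩
  rw [hbal.substGrade_eq hr] at hδ
  exact (ParStep.subst fun x hx => (hτ x (hvar _ _ _ hr hx)).1).anti hδ

/-- Used when both steps contract the root by the same rule up to renaming, so that only the steps
in the substitution remain to be joined. -/
theorem joinable_subst_subst [LawvereanQuantale Ω] {b : L.Term X} {ε δ : Ω}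
    {σ₁ σ₂ : X → L.Term X} {η₁ η₂ : X → Ω}
    (h : ∀ x ∈ vars b, R.Joinable (σ₁ x) (η₁ x) (σ₂ x) (η₂ x))
    (hε : ε ≤ R.substGrade η₁ b) (hδ : δ ≤ R.substGrade η₂ b) :
    R.Joinable (b.subst σ₁) ε (b.subst σ₂) δ := by
  have : ∀ x, ∃ t, x ∈ vars b → R.ParStep (σ₁ x) (η₂ x) t ∧ R.ParStep (σ₂ x) (η₁ x) t := by
    intro x
    by_cases hx : x ∈ vars b
    · exact (h x hx).imp fun _ ht _ => ht
    · exact ⟨.var x, fun hx' => absurd hx' hx⟩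
  choose τ hτ using this
  exact ⟨b.subst τ, (ParStep.subst fun x hx => (hτ x hx).1).anti hδ,
    (ParStep.subst fun x hx => (hτ x hx).2).anti hε⟩

theorem joinable_args {n : ℕ} {f : L.Functions n} {ts₁ ts₂ : Fin n → L.Term X} {η₁ η₂ : Fin n → Ω}
    {ε δ : Ω} (h : ∀ i, R.Joinable (ts₁ i) (η₁ i) (ts₂ i) (η₂ i))
    (hε : ε ≤ ∏ i, R.grade f i (η₁ i)) (hδ : δ ≤ ∏ i, R.grade f i (η₂ i)) :
    R.Joinable (.func f ts₁) ε (.func f ts₂) δ := by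
  choose ts h₁ h₂ using h
  exact ⟨.func f ts, .func f η₂ h₁ hδ, .func f η₁ h₂ hε⟩

/-- A root step with a variable as redex is joined with a second step as soon as the inner step is
joined with that step. -/
theorem joinable_root_var [LawvereanQuantale Ω] (hbal : R.Balanced)
    (hvar : R.VariableCondition) {x : X} {b : L.Term X} {ε₀ ε δ : Ω}
    (hr : R.rule (.var x) ε₀ b) {σ : X → L.Term X} {η : X → Ω} {g : L.Term X}
    (h : R.Joinable (σ x) (η x) g δ) (hε : ε ≤ ε₀ * R.substGrade η (.var x)) :
    R.Joinable (b.subst σ) ε g δ := by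
  -- The redex is a variable, so `g` is its instance under the constant substitution.
  refine joinable_root_subst hbal hvar hr (σ₂ := fun _ => g) (η₁ := η) (η₂ := fun _ => δ)
    (fun y hy => ?_) hε le_rfl
  rw [mem_vars_var.1 hy]
  exact h

theorem eq_var_or_ne_var (t : L.Term X) : (∃ x, t = .var x) ∨ ∀ x, t ≠ .var x := by
  cases t <;> simp

section Tile

variable [LawvereanQuantale Ω] [Infinite X]

theorem Orthogonal.joinable_func (hbal : R.Balanced) (hvar : R.VariableCondition)
    (horth : R.Orthogonal) {n : ℕ} {f : L.Functions n} {ts ts₁ : Fin n → L.Term X}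
    {θ : Fin n → Ω} {ε δ : Ω} {g : L.Term X}
    (hsize : ∀ e, termSize e < termSize (.func f ts) → ∀ f' ε g δ, R.ParStep e ε f' →
      R.ParStep e δ g → R.Joinable f' ε g δ)
    (h₁ : ∀ i, R.ParStep (ts i) (θ i) (ts₁ i)) (hε : ε ≤ ∏ i, R.grade f i (θ i))
    (h₂ : R.ParStep (.func f ts) δ g) : R.Joinable (.func f ts₁) ε g δ := by
  generalize he : Term.func f ts = e at h₂
  -- Induction, not mere case analysis: if a variable redex is contracted, the inner step starts
  -- from the same term and `hsize` does not apply.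
  induction h₂ with
  | var x => simp at he
  | func g' θ' h₂ hδ =>
    simp only [Term.func.injEq] at he
    obtain ⟨rfl, hfg, hargs⟩ := he
    obtain rfl := eq_of_heq hfg
    obtain rfl := eq_of_heq hargs
    exact joinable_args (fun i => hsize _ (termSize_arg_lt _ _ i) _ _ _ _ (h₁ i) (h₂ i)) hε hδ
  | @root a b _ _ σ σ' η hr h₂ hδ ih =>
    obtain ⟨x, rfl⟩ | ha := eq_var_or_ne_var a
    · exact (joinable_root_var hbal hvar hr (ih x (by simp) he).symm hδ).symm
    · obtain ⟨τ, κ, hτ, hκ, hle⟩ := horth.exists_subst_of_args hr ha he h₁ hε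
      rw [hτ]
      refine (joinable_root_subst hbal hvar hr (fun x hx => ?_) hδ hle).symm
      exact hsize _ (he ▸ termSize_lt_subst ha hx σ) _ _ _ _ (h₂ x hx) (hκ x hx)

theorem Orthogonal.joinable_root (hbal : R.Balanced) (hvar : R.VariableCondition)
    (horth : R.Orthogonal) {a b : L.Term X} (ha : ∀ x, a ≠ .var x) {ε₀ ε δ : Ω}
    (hab : R.rule a ε₀ b) {σ σ₁ : X → L.Term X} {θ : X → Ω} {g : L.Term X}
    (hsize : ∀ e, termSize e < termSize (a.subst σ) → ∀ f' ε g δ, R.ParStep e ε f' →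
      R.ParStep e δ g → R.Joinable f' ε g δ)
    (h₁ : ∀ x ∈ vars a, R.ParStep (σ x) (θ x) (σ₁ x)) (hε : ε ≤ ε₀ * R.substGrade θ a)
    (h₂ : R.ParStep (a.subst σ) δ g) : R.Joinable (b.subst σ₁) ε g δ := by
  generalize he : a.subst σ = e at h₂
  induction h₂ with
  | var x =>
    cases a with
    | var y => exact absurd rfl (ha y)
    | func f ts => simp at he
  | func g' θ' h₂ hδ =>
    obtain ⟨τ, κ, hτ, hκ, hle⟩ := horth.exists_subst_of_args hab ha he.symm h₂ hδ
    rw [hτ]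
    exact joinable_root_subst hbal hvar hab (fun x hx =>
      hsize _ (termSize_lt_subst ha hx σ) _ _ _ _ (h₁ x hx) (hκ x hx)) hε hle
  | @root c d _ _ τ τ₁ η hcd h₂ hδ ih =>
    obtain ⟨x, rfl⟩ | hc := eq_var_or_ne_var c
    · exact (joinable_root_var hbal hvar hcd (ih x (by simp) he).symm hδ).symm
    -- Two rules with non-variable left-hand sides applied at the same root are variants, so both
    -- contracta are instances of `b`.
    · obtain ⟨-, ρ, rfl, rfl⟩ := horth.areVariants hab hcd (C := .hole) rfl hc he
      rw [subst_relabel] at he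
      rw [subst_relabel]
      rw [substGrade_relabel, hbal.substGrade_eq hab] at hδ
      rw [hbal.substGrade_eq hab] at hε
      -- The grades of the two contractions are dropped by integrality.
      refine joinable_subst_subst (fun x hx => ?_)
        (hε.trans (mul_le_of_le_one_left' (LawvereanQuantale.le_one _)))
        (hδ.trans (mul_le_of_le_one_left' (LawvereanQuantale.le_one _)))
      have hxa := hvar _ _ _ hab hx
      have hx' := h₂ (ρ x) (by rw [vars_relabel]; exact ⟨x, hxa, rfl⟩)
      have hστ : σ x = τ (ρ x) := eq_of_subst_eq he x hxa
      rw [← hστ] at hx'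
      exact hsize _ (termSize_lt_subst ha hxa σ) _ _ _ _ (h₁ x hxa) hx'

theorem Orthogonal.tile_parStep (hbal : R.Balanced) (hvar : R.VariableCondition)
    (horth : R.Orthogonal) : TRel.Tile R.ParStep := by
  suffices ∀ n, ∀ e : L.Term X, termSize e = n → ∀ f ε g δ, R.ParStep e ε f →
      R.ParStep e δ g → R.Joinable f ε g δ from fun e ε f δ g => this _ e rfl f ε g δ
  intro n
  induction n using Nat.strong_induction_on with
  | _ n ihn =>
    intro e hn f ε g δ h₁ h₂
    have hsize : ∀ e' : L.Term X, termSize e' < termSize e → ∀ f ε g δ, R.ParStep e' ε f →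
      R.ParStep e' δ g → R.Joinable f ε g δ := fun e' he' => ihn _ (hn ▸ he') e' rfl
    clear ihn hn
    -- For a variable redex the inner derivation starts from the same term, so `h₂` and `hsize`
    -- carry over to it.
    induction h₁ with
    | var x ε => exact ⟨g, h₂, .refl g ε⟩
    | func f θ h₁ hε => exact horth.joinable_func hbal hvar hsize h₁ hε h₂
    | @root a b _ _ σ σ' η hr h₁ hε ih =>
      obtain ⟨x, rfl⟩ | ha := eq_var_or_ne_var a
      · exact joinable_root_var hbal hvar hr (ih x (by simp) h₂ hsize) hε
      · exact horth.joinable_root hbal hvar ha hr hsize h₁ hε h₂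

theorem Orthogonal.confluent_step (hbal : R.Balanced) (hvar : R.VariableCondition)
    (horth : R.Orthogonal) : TRel.Confluent R.Step := by
  rw [TRel.Confluent, ← star_parStep]
  exact (horth.tile_parStep hbal hvar).star.diamond

end Tile

end GradedTRS

end GradedRewriting

theorem mainTheorem2 {Ω : Type*} [CommMonoid Ω] [CompleteLattice Ω]
    [GradedRewriting.LawvereanQuantale Ω] (Φ : GradedRewriting.GradeStructure Ω)
    {L : FirstOrder.Language} {X : Type*} [Infinite X]
    (R : GradedRewriting.GradedTRS Φ L X)
    (hbal : R.Balanced) (hvar : R.VariableCondition) (horth : R.Orthogonal) :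
    GradedRewriting.QRel.Confluent R.rel ∧ GradedRewriting.TRel.Confluent R.Step :=
  ⟨GradedRewriting.TRel.Confluent.toQRel (horth.confluent_step hbal hvar),
    horth.confluent_step hbal hvar⟩
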